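/- Let $\alpha>1$ be an irrational number, let $k\ge 2$ be an integer, and let $f$ be a nonconstant polynomial with integer coefficients, all of whose nonzero coefficients are positive. For a set $A$ of positive integers put $$S(A)=\{f(a_1)+\cdots+f(a_k): a_1,\dots,a_k\in A\}$$ (repetitions among the $a_i$ allowed) and let $\mathcal B_\alpha=\{\lfloor n\alpha\rfloor : n=1,2,3,\dots\}$. Let $\overline d(A)=\limsup_{N\to\infty}|A\cap[1,N]|/N$ be the upper asymptotic density of $A$, and say that $A$ has density $d$ if $\lim_{N\to\infty}|A\cap[1,N]|/N$ exists and equals $d$. Then $\frac1k-\frac1{k\alpha}$, which is positive, is the optimal density for sets $A$ of positive integers with $S(A)\cap\mathcal B_\alpha=\emptyset$. That is: 1. there is an infinite set $A$ of positive integers that has density $\frac1k-\frac1{k\alpha}$ and satisfies $S(A)\cap\mathcal B_\alpha=\emptyset$; 2. every set $A$ of positive integers with $S(A)\cap\mathcal B_\alpha=\emptyset$ satisfies $\overline d(A)\le\frac1k-\frac1{k\alpha}$; moreover, if $A$ is a set of positive integers with $\overline d(A)>\frac1k-\frac1{k\alpha}$, then $S(A)\cap\mathcal B_\alpha$ is infinite.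 -/

import Mathlib

open Filter Topology Polynomial

noncomputable section

/-- The proportion of the integers `1, …, N` that lie in `A`. -/
def densityUpTo (A : Set ℕ) (N : ℕ) : ℝ :=
  ((A ∩ Set.Icc 1 N).ncard : ℝ) / (N : ℝ)

/-- `A` has asymptotic density `d`: the limit of `|A ∩ [1, N]| / N` exists and equals `d`. -/
def HasAsymptoticDensity (A : Set ℕ) (d : ℝ) : Prop :=
  Tendsto (densityUpTo A) atTop (𝓝 d)

/-- The upper asymptotic density `limsup |A ∩ [1, N]| / N`. The quotients lie in `[0, 1]`, so
this real limsup is the genuine one. -/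
def upperAsymptoticDensity (A : Set ℕ) : ℝ :=
  limsup (densityUpTo A) atTop

/-- The set of all sums `f(a₁) + ⋯ + f(aₖ)` with `a₁, …, aₖ ∈ A`, repetitions allowed. -/
def kFoldSums (f : ℕ[X]) (k : ℕ) (A : Set ℕ) : Set ℕ :=
  {m | ∃ a : Fin k → ℕ, (∀ i, a i ∈ A) ∧ m = ∑ i, f.eval (a i)}

/-- The Beatty set `{⌊nα⌋ : n = 1, 2, …}`, for `α ≥ 0`, as a set of natural numbers. -/
def beattySet (α : ℝ) : Set ℕ :=
  {m | ∃ n : ℕ, 0 < n ∧ (m : ℤ) = beattySeq α n}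

theorem densityUpTo_nonneg (A : Set ℕ) (N : ℕ) : 0 ≤ densityUpTo A N := by
  unfold densityUpTo; positivity

theorem densityUpTo_le_one (A : Set ℕ) (N : ℕ) : densityUpTo A N ≤ 1 := by
  unfold densityUpTo
  apply div_le_one_of_le₀ _ (Nat.cast_nonneg N)
  have h := Set.ncard_le_ncard (Set.inter_subset_right (s := A)) (Set.finite_Icc 1 N)
  have h2 : (Set.Icc 1 N).ncard = N := by
    rw [← Finset.coe_Icc, Set.ncard_coe_finset]; simp
  exact_mod_cast h2 ▸ h

end

/-! As `α` is irrational, `m` lies in the Beatty set exactly when the fractional part of `m/α`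
exceeds `1 - 1/α`. Sums of values of `f` must therefore avoid an arc of length `1/α` on the circle,
while the points `f(n)/α` are equidistributed there (`hasAsymptoticDensity_fract_eval_mul`, by
Weyl's method).

Existence: take all `n` with `f(n)/α` in the arc `[0, (1 - 1/α)/k)`. Then `k` fractional parts add
up without reaching the forbidden arc.

Optimality: cut the circle into `p` equal arcs, `p` a large prime, and let `E` be the set of arcs,
as residues mod `p`, met by `f(a)/α` for large `a` in `A`. Equidistribution bounds the upper density
of `A` by `|E|/p`. If sums of large elements miss the Beatty set, the `k`-fold sumset of `E` fits
into about `p(1 - 1/α)` residues, up to an error depending only on `k`, while Cauchy–Davenport gives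
it at least `min(p, k(|E| - 1) + 1)`. Letting `p` grow yields the bound
(`upperAsymptoticDensity_le_of_disjoint`). -/

/-! ### Van der Corput's difference theorem -/

/-- A form of van der Corput's inequality. -/
theorem norm_sum_le_of_correlations (u : ℕ → ℂ) (hu : ∀ n, ‖u n‖ ≤ 1) (H N : ℕ) :
    H * ‖∑ n ∈ Finset.range N, u n‖ ≤
      √(N * (H * N + ∑ p ∈ (Finset.range H).offDiag,
        ‖∑ n ∈ Finset.range N, u (n + p.1) * star (u (n + p.2))‖)) + 2 * H * H := by
  -- A shift by `h` changes only `h` terms at each end of the sum.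
  have hshift : ∀ h < H, ‖∑ n ∈ Finset.range N, u (n + h) - ∑ n ∈ Finset.range N, u n‖ ≤ 2 * H := by
    intro h hh
    have e1 : ∑ n ∈ Finset.range N, u (n + h) + ∑ n ∈ Finset.range h, u n =
        ∑ n ∈ Finset.range h, u (N + n) + ∑ n ∈ Finset.range N, u n := by
      have h1 := Finset.sum_range_add u h N
      have h2 := Finset.sum_range_add u N h
      rw [add_comm h N] at h1
      simp only [add_comm h] at h1
      linear_combination h2 - h1
    have hb : ∀ w : ℕ → ℂ, (∀ n, ‖w n‖ ≤ 1) → ‖∑ n ∈ Finset.range h, w n‖ ≤ H := by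
      intro w hw
      refine (norm_sum_le_of_le _ (fun n _ => hw n)).trans ?_
      simpa using hh.le
    have e2 : ∑ n ∈ Finset.range N, u (n + h) - ∑ n ∈ Finset.range N, u n =
        ∑ n ∈ Finset.range h, u (N + n) - ∑ n ∈ Finset.range h, u n := by
      linear_combination e1
    rw [e2]
    refine (norm_sub_le _ _).trans ?_
    linarith [hb u hu, hb (fun n => u (N + n)) (fun n => hu _)]
  set V := ∑ n ∈ Finset.range N, ∑ h ∈ Finset.range H, u (n + h) with hV
  have h1 : ‖V - H * ∑ n ∈ Finset.range N, u n‖ ≤ 2 * H * H := by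
    have : V - H * ∑ n ∈ Finset.range N, u n =
        ∑ h ∈ Finset.range H, (∑ n ∈ Finset.range N, u (n + h) - ∑ n ∈ Finset.range N, u n) := by
      rw [hV, Finset.sum_comm, Finset.sum_sub_distrib]; simp
    rw [this]
    refine (norm_sum_le_of_le _ (fun h hh => hshift h (Finset.mem_range.1 hh))).trans ?_
    simp; linarith
  -- Expanding the square gives the correlations; the diagonal pairs account for `H * N`.
  have hsq : ∑ n ∈ Finset.range N, ‖∑ h ∈ Finset.range H, u (n + h)‖ ^ 2 ≤
      H * N + ∑ p ∈ (Finset.range H).offDiag,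
        ‖∑ n ∈ Finset.range N, u (n + p.1) * star (u (n + p.2))‖ := by
    have e : ((∑ n ∈ Finset.range N, ‖∑ h ∈ Finset.range H, u (n + h)‖ ^ 2 : ℝ) : ℂ) =
        ∑ p ∈ Finset.range H ×ˢ Finset.range H,
          ∑ n ∈ Finset.range N, u (n + p.1) * star (u (n + p.2)) := by
      rw [Finset.sum_comm]
      push_cast
      refine Finset.sum_congr rfl fun n _ => ?_
      rw [← Complex.mul_conj', map_sum, Finset.sum_mul_sum, Finset.sum_product]
      rfl
    have e3 : (∑ n ∈ Finset.range N, ‖∑ h ∈ Finset.range H, u (n + h)‖ ^ 2 : ℝ) =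
        ‖((∑ n ∈ Finset.range N, ‖∑ h ∈ Finset.range H, u (n + h)‖ ^ 2 : ℝ) : ℂ)‖ := by
      rw [Complex.norm_real, Real.norm_of_nonneg (by positivity)]
    rw [e3, e, ← Finset.diag_union_offDiag, Finset.sum_union (Finset.disjoint_diag_offDiag _)]
    refine (norm_add_le _ _).trans (add_le_add ?_ (norm_sum_le _ _))
    rw [Finset.sum_diag]
    have hN : ∀ h ∈ Finset.range H,
        ‖∑ n ∈ Finset.range N, u (n + h) * star (u (n + h))‖ ≤ (N : ℝ) := by
      intro h _
      have h1 : ∀ n ∈ Finset.range N, ‖u (n + h) * star (u (n + h))‖ ≤ 1 := fun n _ => by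
        rw [norm_mul, norm_star]
        exact mul_le_one₀ (hu _) (norm_nonneg _) (hu _)
      simpa using norm_sum_le_of_le _ h1
    simpa using norm_sum_le_of_le _ hN
  have hcs : ‖V‖ ^ 2 ≤ N * ∑ n ∈ Finset.range N, ‖∑ h ∈ Finset.range H, u (n + h)‖ ^ 2 := by
    have := sq_sum_le_card_mul_sum_sq (s := Finset.range N)
      (f := fun n => ‖∑ h ∈ Finset.range H, u (n + h)‖)
    rw [Finset.card_range] at this
    exact (pow_le_pow_left₀ (norm_nonneg _) (norm_sum_le _ _) 2).trans this
  have hV2 : ‖V‖ ≤ √(N * (H * N + ∑ p ∈ (Finset.range H).offDiag,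
        ‖∑ n ∈ Finset.range N, u (n + p.1) * star (u (n + p.2))‖)) :=
    Real.le_sqrt_of_sq_le (hcs.trans (by gcongr))
  have h2 : ‖(H : ℂ) * ∑ n ∈ Finset.range N, u n‖ = H * ‖∑ n ∈ Finset.range N, u n‖ := by simp
  rw [← h2]
  have := norm_sub_norm_le ((H : ℂ) * ∑ n ∈ Finset.range N, u n) V
  rw [norm_sub_rev] at this
  linarith

/-- **van der Corput's difference theorem**: a bounded sequence all of whose correlations have mean
zero has itself mean zero. -/
theorem tendsto_mean_zero_of_correlations (u : ℕ → ℂ) (hu : ∀ n, ‖u n‖ ≤ 1)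
    (hcorr : ∀ h h' : ℕ, h ≠ h' → Tendsto (fun N : ℕ =>
      (∑ n ∈ Finset.range N, u (n + h) * star (u (n + h'))) / (N : ℂ)) atTop (𝓝 0)) :
    Tendsto (fun N : ℕ => (∑ n ∈ Finset.range N, u n) / (N : ℂ)) atTop (𝓝 0) := by
  have key : ∀ H : ℕ, 0 < H → Tendsto (fun N : ℕ =>
      √(H + ∑ p ∈ (Finset.range H).offDiag,
        ‖(∑ n ∈ Finset.range N, u (n + p.1) * star (u (n + p.2))) / (N : ℂ)‖) / H
        + 2 * H / (N : ℝ)) atTop (𝓝 (√(H + ∑ p ∈ (Finset.range H).offDiag, (0 : ℝ)) / H + 0)) := by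
    intro H hH
    refine Tendsto.add (Tendsto.div_const (Tendsto.sqrt (tendsto_const_nhds.add
      (tendsto_finsetSum _ fun p hp => ?_))) _) (tendsto_const_div_atTop_nhds_zero_nat _)
    simpa using (hcorr p.1 p.2 (Finset.mem_offDiag.1 hp).2.2).norm
  have bound : ∀ H : ℕ, 0 < H → ∀ N : ℕ, 0 < N → ‖(∑ n ∈ Finset.range N, u n) / (N : ℂ)‖ ≤
      √(H + ∑ p ∈ (Finset.range H).offDiag,
        ‖(∑ n ∈ Finset.range N, u (n + p.1) * star (u (n + p.2))) / (N : ℂ)‖) / H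
        + 2 * H / (N : ℝ) := by
    intro H hH N hN
    have h := norm_sum_le_of_correlations u hu H N
    have hH' : (0 : ℝ) < H := by exact_mod_cast hH
    have hN' : (0 : ℝ) < N := by exact_mod_cast hN
    simp only [norm_div, Complex.norm_natCast]
    rw [← Finset.sum_div]
    set S := ∑ p ∈ (Finset.range H).offDiag,
        ‖∑ n ∈ Finset.range N, u (n + p.1) * star (u (n + p.2))‖
    have e : (N : ℝ) * (H * N + S) = N ^ 2 * (H + S / N) := by field_simp
    rw [e, Real.sqrt_mul (by positivity), Real.sqrt_sq hN'.le] at h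
    rw [div_le_iff₀ hN']
    have : (√(H + S / N) / H + 2 * H / N) * N = (N * √(H + S / N) + 2 * H * H) / H := by
      field_simp
    rw [this, le_div_iff₀ hH']
    linarith
  rw [Metric.tendsto_atTop]
  intro ε hε
  -- As `N → ∞` with `H` fixed, the bound tends to `√H / H = 1 / √H`, which is then below `ε`.
  obtain ⟨H, hH⟩ := exists_nat_gt (1 / ε ^ 2)
  have hH0 : (0 : ℝ) < H := lt_trans (by positivity) hH
  have hHn : 0 < H := by exact_mod_cast hH0
  have hlim : √(H + ∑ p ∈ (Finset.range H).offDiag, (0 : ℝ)) / H + 0 < ε := by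
    simp only [Finset.sum_const_zero, add_zero]
    rw [Real.sqrt_div_self', div_lt_iff₀ (by positivity)]
    rw [div_lt_iff₀ (by positivity)] at hH
    have : 1 < (ε * √H) ^ 2 := by rw [mul_pow, Real.sq_sqrt hH0.le]; linarith
    exact (one_lt_sq_iff₀ (by positivity)).1 this
  obtain ⟨N0, hN0⟩ := eventually_atTop.1 ((key H hHn).eventually_lt_const hlim)
  refine ⟨N0 + 1, fun N hN => ?_⟩
  rw [dist_zero_right]
  exact (bound H hHn N (by omega)).trans_lt (hN0 N (by omega))

/-! ### Exponential sums of polynomials -/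

theorem natDegree_taylor_sub_taylor_lt (g : ℤ[X]) (hg : 0 < g.natDegree) (r s : ℤ) :
    (taylor r g - taylor s g).natDegree < g.natDegree := by
  have h1 : (taylor r g - taylor s g).natDegree ≤ g.natDegree :=
    (natDegree_sub_le _ _).trans (by simp [natDegree_taylor])
  refine lt_of_le_of_ne h1 fun h => ?_
  have h2 : (taylor r g - taylor s g).coeff g.natDegree = 0 := by
    rw [coeff_sub, coeff_taylor_natDegree, coeff_taylor_natDegree, sub_self]
  rw [← h, coeff_natDegree, leadingCoeff_eq_zero] at h2
  rw [h2] at h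
  simp at h
  omega

/-- In degree `d + 1` with leading coefficient `c`, the coefficient of `X ^ d` in the difference is
`(d + 1) * c * (r - s)`. The difference is thus nonconstant, as the induction on the degree in
Weyl's theorem requires. -/
theorem natDegree_taylor_sub_taylor_pos (g : ℤ[X]) (hg : 2 ≤ g.natDegree) {r s : ℤ} (hrs : r ≠ s) :
    0 < (taylor r g - taylor s g).natDegree := by
  obtain ⟨d, hd⟩ : ∃ d, g.natDegree = d + 1 := ⟨g.natDegree - 1, by omega⟩
  refine lt_of_lt_of_le (show 0 < d by omega) (le_natDegree_of_ne_zero ?_)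
  have hdeg : (hasseDeriv d g).natDegree ≤ 1 := (natDegree_hasseDeriv_le _ _).trans (by omega)
  rw [coeff_sub, taylor_coeff, taylor_coeff, eq_X_add_C_of_natDegree_le_one hdeg]
  have hc : (hasseDeriv d g).coeff 1 ≠ 0 := by
    rw [hasseDeriv_coeff, add_comm 1 d, ← hd, coeff_natDegree]
    refine mul_ne_zero ?_ (leadingCoeff_ne_zero.2 fun h => by simp [h] at hg)
    rw [hd]; simp; omega
  simp only [eval_add, eval_mul, eval_C, eval_X, add_sub_add_right_eq_sub, ← mul_sub]
  exact mul_ne_zero hc (sub_ne_zero.2 hrs)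

theorem tendsto_mean_pow_zero {z : ℂ} (hz : ‖z‖ = 1) (hz1 : z ≠ 1) :
    Tendsto (fun N : ℕ => (∑ n ∈ Finset.range N, z ^ n) / (N : ℂ)) atTop (𝓝 0) := by
  refine squeeze_zero_norm (a := fun N : ℕ => (2 / ‖z - 1‖) / (N : ℝ)) (fun N => ?_)
    (tendsto_const_div_atTop_nhds_zero_nat _)
  rw [geom_sum_eq hz1, norm_div, norm_div, Complex.norm_natCast]
  gcongr
  refine (norm_sub_le _ _).trans ?_
  rw [norm_pow, hz]; norm_num

/-- **Weyl's theorem on exponential sums** of integer polynomials times an irrational. -/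
theorem tendsto_mean_toCircle_eval_mul (g : ℤ[X]) (hg : 0 < g.natDegree) {θ : ℝ}
    (hθ : Irrational θ) :
    Tendsto (fun N : ℕ => (∑ n ∈ Finset.range N,
      (AddCircle.toCircle (((g.eval (n : ℤ) : ℤ) * θ : ℝ) : UnitAddCircle) : ℂ)) / (N : ℂ))
      atTop (𝓝 0) := by
  induction hd : g.natDegree using Nat.strong_induction_on generalizing g with
  | _ d ih =>
  subst hd
  rcases Nat.lt_or_ge g.natDegree 2 with h2 | h2
  -- Linear case: a geometric sum whose ratio is not 1 because `θ` is irrational.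
  · have hdeg : g.natDegree = 1 := by omega
    have ha : g.coeff 1 ≠ 0 := by
      rw [← hdeg, coeff_natDegree]; exact leadingCoeff_ne_zero.2 fun h => by simp [h] at hg
    set z := AddCircle.toCircle ((g.coeff 1 * θ : ℝ) : UnitAddCircle) with hz
    set w := AddCircle.toCircle ((g.coeff 0 * θ : ℝ) : UnitAddCircle)
    have hz1 : z ≠ 1 := by
      rw [hz, ← AddCircle.toCircle_zero (T := 1)]
      intro h
      obtain ⟨m, hm⟩ := AddCircle.coe_eq_zero_iff _ |>.1
        (AddCircle.injective_toCircle one_ne_zero h)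
      refine (hθ.intCast_mul ha).ne_int m ?_
      rw [← hm]; simp
    have := (tendsto_mean_pow_zero (Circle.norm_coe z)
      (fun h => hz1 (Circle.coe_eq_one.1 h))).const_mul (w : ℂ)
    rw [mul_zero] at this
    refine this.congr fun N => ?_
    rw [← mul_div_assoc, Finset.mul_sum]
    congr 1
    refine Finset.sum_congr rfl fun n _ => ?_
    have : (((g.eval (n : ℤ) : ℤ) * θ : ℝ) : UnitAddCircle) =
        ((g.coeff 0 * θ : ℝ) : UnitAddCircle) + n • ((g.coeff 1 * θ : ℝ) : UnitAddCircle) := by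
      rw [← AddCircle.coe_nsmul, ← AddCircle.coe_add]
      congr 1
      conv_lhs => rw [eq_X_add_C_of_natDegree_le_one hdeg.le]
      simp
      ring
    rw [this, AddCircle.toCircle_add, AddCircle.toCircle_nsmul]
    simp [w, z]
  -- The correlations are exponential sums of `g(X + h) - g(X + h')`, which has smaller positive
  -- degree.
  · refine tendsto_mean_zero_of_correlations _ (fun n => (Circle.norm_coe _).le) fun h h' hh => ?_
    have hh' : (h : ℤ) ≠ h' := by exact_mod_cast hh
    refine (ih _ (natDegree_taylor_sub_taylor_lt g hg h h') _
      (natDegree_taylor_sub_taylor_pos g h2 hh') rfl).congr fun N => ?_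
    congr 1
    refine Finset.sum_congr rfl fun n _ => ?_
    rw [eval_sub, taylor_eval, taylor_eval]
    push_cast
    rw [sub_mul, AddCircle.coe_sub, sub_eq_add_neg, AddCircle.toCircle_add, AddCircle.toCircle_neg,
      Circle.coe_mul, Circle.coe_inv_eq_conj]
    rfl

/-! ### Weyl's criterion and equidistribution -/

open MeasureTheory in
/-- One half of Weyl's criterion: if all nontrivial exponential means tend to zero, then the means
of every continuous function tend to its integral. -/
theorem tendsto_mean_of_fourier (x : ℕ → UnitAddCircle)
    (hx : ∀ m : ℤ, m ≠ 0 → Tendsto (fun N : ℕ =>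
      (∑ n ∈ Finset.range N, fourier m (x n)) / (N : ℂ)) atTop (𝓝 0)) (F : C(UnitAddCircle, ℂ)) :
    Tendsto (fun N : ℕ => (∑ n ∈ Finset.range N, F (x n)) / (N : ℂ)) atTop (𝓝 (∫ t, F t)) := by
  have hint : ∀ G : C(UnitAddCircle, ℂ), Integrable G volume := fun G =>
    G.continuous.integrable_of_hasCompactSupport (HasCompactSupport.of_compactSpace _)
  have hspan : ∀ G ∈ Submodule.span ℂ (Set.range (@fourier 1)),
      Tendsto (fun N : ℕ => (∑ n ∈ Finset.range N, G (x n)) / (N : ℂ)) atTop (𝓝 (∫ t, G t)) := by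
    intro G hG
    induction hG using Submodule.span_induction with
    | mem G hG =>
      obtain ⟨m, rfl⟩ := hG
      rcases eq_or_ne m 0 with rfl | hm
      · simp only [fourier_zero]
        refine tendsto_const_nhds.congr' ?_
        filter_upwards [eventually_gt_atTop 0] with N hN
        have : (N : ℂ) ≠ 0 := by exact_mod_cast hN.ne'
        simp [this, Measure.real]
      -- Translation by half a period of the character changes its sign.
      · have : ∫ t : UnitAddCircle, (fourier m t : ℂ) = 0 :=
          integral_eq_zero_of_add_right_eq_neg (fourier_add_half_inv_index hm one_pos)
        rw [this]
        exact hx m hm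
    | zero => simp
    | add G₁ G₂ _ _ h₁ h₂ =>
      simp only [ContinuousMap.add_apply, integral_add (hint G₁) (hint G₂)]
      refine (h₁.add h₂).congr fun N => ?_
      rw [Finset.sum_add_distrib, add_div]
    | smul c G _ h =>
      simp only [ContinuousMap.smul_apply, smul_eq_mul]
      rw [integral_const_mul]
      refine (h.const_mul c).congr fun N => ?_
      rw [← Finset.mul_sum, mul_div_assoc]
  rw [Metric.tendsto_atTop]
  intro ε hε
  have hF : F ∈ (Submodule.span ℂ (Set.range (@fourier 1))).topologicalClosure := by
    rw [span_fourier_closure_eq_top]; trivial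
  obtain ⟨G, hG, hFG⟩ := Metric.mem_closure_iff.1 hF (ε / 3) (by positivity)
  obtain ⟨N0, hN0⟩ := Metric.tendsto_atTop.1 (hspan G hG) (ε / 3) (by positivity)
  refine ⟨N0, fun N hN => ?_⟩
  have hpt : ∀ t, ‖F t - G t‖ ≤ ε / 3 := fun t => by
    rw [← dist_eq_norm]; exact (ContinuousMap.dist_apply_le_dist t).trans hFG.le
  have h1 : dist ((∑ n ∈ Finset.range N, F (x n)) / (N : ℂ))
      ((∑ n ∈ Finset.range N, G (x n)) / (N : ℂ)) ≤ ε / 3 := by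
    rw [dist_eq_norm, ← sub_div, ← Finset.sum_sub_distrib, norm_div, Complex.norm_natCast]
    refine div_le_of_le_mul₀ (by positivity) (by positivity) ?_
    refine (norm_sum_le_of_le _ fun n _ => hpt (x n)).trans ?_
    simp [mul_comm]
  have h2 : dist (∫ t, G t) (∫ t, F t) ≤ ε / 3 := by
    rw [dist_comm, dist_eq_norm, ← integral_sub (hint F) (hint G)]
    simpa [Measure.real] using norm_integral_le_of_norm_le_const (μ := volume) (ae_of_all _ hpt)
  have h3 := hN0 N hN
  linarith [dist_triangle4 ((∑ n ∈ Finset.range N, F (x n)) / (N : ℂ))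
    ((∑ n ∈ Finset.range N, G (x n)) / (N : ℂ)) (∫ t, G t) (∫ t, F t)]

theorem coe_mem_image_Ico_iff {a b : ℝ} (ha : 0 ≤ a) (hb : b ≤ 1) (y : ℝ) :
    (y : UnitAddCircle) ∈ ((↑) : ℝ → UnitAddCircle) '' Set.Ico a b ↔ Int.fract y ∈ Set.Ico a b := by
  constructor
  · rintro ⟨z, hz, hzy⟩
    rw [← AddCircle.coe_fract y, AddCircle.coe_eq_coe_iff_of_mem_Ico (a := 0)
      ⟨ha.trans hz.1, by linarith [hz.2]⟩
      ⟨Int.fract_nonneg y, by linarith [Int.fract_lt_one y]⟩] at hzy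
    exact hzy ▸ hz
  · exact fun h => ⟨_, h, AddCircle.coe_fract y⟩

theorem isOpen_image_Ioo (a b : ℝ) : IsOpen (((↑) : ℝ → UnitAddCircle) '' Set.Ioo a b) :=
  QuotientAddGroup.isOpenMap_coe _ isOpen_Ioo

theorem measurableSet_image_Ico (a b : ℝ) :
    MeasurableSet (((↑) : ℝ → UnitAddCircle) '' Set.Ico a b) := by
  rcases lt_or_ge a b with h | h
  · rw [← Set.Ioo_insert_left h, Set.image_insert_eq]
    exact (isOpen_image_Ioo a b).measurableSet.insert _
  · simp [Set.Ico_eq_empty h.not_gt]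

open MeasureTheory in
theorem volume_image_Ico {a b : ℝ} (ha : 0 ≤ a) (hb : b ≤ 1) :
    volume (((↑) : ℝ → UnitAddCircle) '' Set.Ico a b) = ENNReal.ofReal (b - a) := by
  rw [AddCircle.add_projection_respects_measure 1 0 (measurableSet_image_Ico a b)]
  apply le_antisymm
  -- The fundamental domain is `(0, 1]`, so the point 0 of the circle appears as 1, an extra null
  -- set.
  · refine (measure_mono (t := Set.Ico a b ∪ {1}) ?_).trans ((measure_union_le _ _).trans (by simp))
    rintro y ⟨hy, hy0, hy1⟩
    rw [zero_add] at hy1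
    rcases hy1.eq_or_lt with rfl | hy1
    · exact Or.inr rfl
    · have := (coe_mem_image_Ico_iff ha hb y).1 hy
      rw [Int.fract_eq_self.2 ⟨hy0.le, hy1⟩] at this
      exact Or.inl this
  · rw [← Real.volume_Ioo]
    exact measure_mono fun y hy =>
      ⟨⟨y, ⟨hy.1.le, hy.2⟩, rfl⟩, ha.trans_lt hy.1, by linarith [hy.2]⟩

open MeasureTheory in
-- Only the two endpoints can lie on the frontier. This permits passing from weak convergence of
-- measures to the measure of an arc.
theorem volume_frontier_image_Ico (a b : ℝ) :
    volume (frontier (((↑) : ℝ → UnitAddCircle) '' Set.Ico a b)) = 0 := by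
  have hfin : (((↑) : ℝ → UnitAddCircle) '' {a, b}).Finite := (Set.toFinite _).image _
  have : NullSingletonClass (volume : Measure UnitAddCircle) := ⟨fun t => by
    simpa using AddCircle.volume_closedBall 1 (x := t) 0⟩
  refine measure_mono_null ?_ (hfin.measure_zero _)
  have hcl : closure (((↑) : ℝ → UnitAddCircle) '' Set.Ico a b) ⊆
      ((↑) : ℝ → UnitAddCircle) '' Set.Icc a b :=
    closure_minimal (Set.image_mono Set.Ico_subset_Icc_self)
      (isCompact_Icc.image (AddCircle.continuous_mk' 1)).isClosed
  have hint : ((↑) : ℝ → UnitAddCircle) '' Set.Ioo a b ⊆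
      interior (((↑) : ℝ → UnitAddCircle) '' Set.Ico a b) :=
    interior_maximal (Set.image_mono Set.Ioo_subset_Ico_self)
      (isOpen_image_Ioo a b)
  rintro t ⟨ht1, ht2⟩
  obtain ⟨y, hy, rfl⟩ := hcl ht1
  refine ⟨y, ?_, rfl⟩
  by_contra h
  simp only [Set.mem_insert_iff, Set.mem_singleton_iff, not_or] at h
  exact ht2 (hint ⟨y, ⟨lt_of_le_of_ne hy.1 (Ne.symm h.1), lt_of_le_of_ne hy.2 h.2⟩, rfl⟩)

open MeasureTheory in
/-- **Weyl's criterion**. -/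
theorem tendsto_card_fract_mem_Ico (x : ℕ → ℝ)
    (hx : ∀ m : ℤ, m ≠ 0 → Tendsto (fun N : ℕ =>
      (∑ n ∈ Finset.range N, fourier m (x n : UnitAddCircle)) / (N : ℂ)) atTop (𝓝 0))
    {a b : ℝ} (ha : 0 ≤ a) (hab : a ≤ b) (hb : b ≤ 1) :
    Tendsto (fun N : ℕ =>
      (((Finset.range N).filter fun n => Int.fract (x n) ∈ Set.Ico a b).card : ℝ) / (N : ℝ)) atTop (𝓝 (b - a)) := by
  -- Empirical measures of the first `N + 1` points; the shift makes each a probability measure.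
  let μ : ℕ → Measure UnitAddCircle := fun N =>
    ((N + 1 : ℕ) : ENNReal)⁻¹ • ∑ n ∈ Finset.range (N + 1), Measure.dirac (x n : UnitAddCircle)
  have hprob : ∀ N, IsProbabilityMeasure (μ N) := fun N => ⟨by
    simp only [μ, Measure.smul_apply, Measure.finsetSum_apply, measure_univ, Finset.sum_const,
      Finset.card_range, smul_eq_mul, nsmul_eq_mul, mul_one]
    exact ENNReal.inv_mul_cancel (by simp) (by simp)⟩
  obtain ⟨P, hP⟩ : ∃ P : ℕ → ProbabilityMeasure UnitAddCircle, ∀ N, (P N : Measure UnitAddCircle) = μ N :=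
    ⟨fun N => .mk (μ N) (hprob N), fun _ => rfl⟩
  obtain ⟨ν, hν⟩ : ∃ ν : ProbabilityMeasure UnitAddCircle, (ν : Measure UnitAddCircle) = volume :=
    ⟨.mk volume ⟨UnitAddCircle.measure_univ⟩, rfl⟩
  have hlim : Tendsto P atTop (𝓝 ν) := by
    rw [ProbabilityMeasure.tendsto_iff_forall_integral_rclike_tendsto ℂ]
    intro F
    simp only [hP, hν]
    refine ((tendsto_mean_of_fourier (fun n => x n) hx F.toContinuousMap).comp
      (tendsto_add_atTop_nat 1)).congr fun N => ?_
    simp only [μ, Function.comp]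
    rw [integral_smul_measure, integral_finsetSum_measure (fun i _ => F.integrable _)]
    rw [ENNReal.toReal_inv, ENNReal.toReal_natCast]
    simp [div_eq_inv_mul]
  have h := ProbabilityMeasure.tendsto_measure_of_null_frontier_of_tendsto' hlim
    (hν ▸ volume_frontier_image_Ico a b)
  simp only [hP, hν] at h
  have h' := (ENNReal.tendsto_toReal (measure_ne_top _ _)).comp h
  rw [volume_image_Ico ha hb, ENNReal.toReal_ofReal (sub_nonneg.2 hab)] at h'
  rw [← tendsto_add_atTop_iff_nat 1]
  refine h'.congr fun N => ?_
  have hterm : ∀ n, Measure.dirac (x n : UnitAddCircle) (((↑) : ℝ → UnitAddCircle) '' Set.Ico a b) =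
      if Int.fract (x n) ∈ Set.Ico a b then 1 else 0 := fun n => by
    rw [Measure.dirac_apply' _ (measurableSet_image_Ico a b)]
    classical
    rw [Set.indicator_apply]
    exact if_congr (coe_mem_image_Ico_iff ha hb (x n)) rfl rfl
  simp only [Function.comp, μ, Measure.smul_apply, Measure.finsetSum_apply, hterm,
    Finset.sum_boole, smul_eq_mul, ENNReal.toReal_mul, ENNReal.toReal_inv, ENNReal.toReal_natCast]
  rw [div_eq_inv_mul]

theorem hasAsymptoticDensity_fract_eval_mul (f : ℕ[X]) (hf : 0 < f.natDegree) {θ : ℝ}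
    (hθ : Irrational θ) {a b : ℝ} (ha : 0 ≤ a) (hab : a ≤ b) (hb : b ≤ 1) :
    HasAsymptoticDensity {n | 0 < n ∧ Int.fract ((f.eval n : ℕ) * θ) ∈ Set.Ico a b} (b - a) := by
  -- Densities count from 1 and exponential means from 0, hence the shift of the variable.
  set g : ℤ[X] := taylor 1 (f.map (Nat.castRingHom ℤ)) with hg
  have hgdeg : g.natDegree = f.natDegree := by
    rw [hg, natDegree_taylor, natDegree_map_eq_of_injective Nat.cast_injective]
  have hgeval : ∀ n : ℕ, g.eval (n : ℤ) = f.eval (n + 1) := by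
    intro n
    rw [hg, taylor_eval, ← Nat.cast_succ, eval_natCast_map]
    simp
  have h := tendsto_card_fract_mem_Ico (fun n => (f.eval (n + 1) : ℕ) * θ) (fun m hm => by
    refine (tendsto_mean_toCircle_eval_mul g (hgdeg ▸ hf) (hθ.intCast_mul hm)).congr fun N => ?_
    congr 1
    refine Finset.sum_congr rfl fun n _ => ?_
    rw [fourier_apply, ← AddCircle.coe_zsmul, hgeval]
    congr 3
    simp; ring) ha hab hb
  refine h.congr fun N => ?_
  unfold densityUpTo
  congr 2
  rw [← Finset.card_map (addRightEmbedding 1), ← Set.ncard_coe_finset]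
  congr 1
  ext n
  simp only [Finset.coe_map, Finset.coe_filter, Finset.mem_range, addRightEmbedding_apply,
    Set.mem_image, Set.mem_ofPred_eq, Set.mem_inter_iff, Set.mem_Icc]
  constructor
  · rintro ⟨n, h, rfl⟩
    exact ⟨⟨by omega, h.2⟩, by omega, by omega⟩
  · rintro ⟨⟨h1, h2⟩, h3, h4⟩
    refine ⟨n - 1, ?_⟩
    rw [Nat.sub_add_cancel h3]
    exact ⟨⟨by omega, h2⟩, rfl⟩

/-! ### The Beatty set in terms of fractional parts -/

theorem mem_beattySet_of_fract {α : ℝ} (hα : 1 < α) {m : ℕ}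
    (hm : 1 - α⁻¹ < Int.fract (m * α⁻¹)) : m ∈ beattySet α := by
  have hα0 : 0 < α := one_pos.trans hα
  have hfl : 0 ≤ ⌊(m : ℝ) * α⁻¹⌋ := Int.floor_nonneg.2 (by positivity)
  -- The index must lie in `[m/α, (m + 1)/α)`; the hypothesis puts the next integer after `m/α`
  -- there.
  refine ⟨(⌊(m : ℝ) * α⁻¹⌋ + 1).toNat, by omega, ?_⟩
  rw [beattySeq, eq_comm, Int.floor_eq_iff, Int.toNat_of_nonneg (by omega)]
  have h1 := Int.lt_floor_add_one ((m : ℝ) * α⁻¹)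
  have h2 := Int.floor_add_fract ((m : ℝ) * α⁻¹)
  push_cast
  constructor
  · rw [← div_eq_mul_inv, div_lt_iff₀ hα0, div_eq_mul_inv] at h1
    exact h1.le
  · rw [← lt_div_iff₀ hα0, div_eq_mul_inv, add_mul, one_mul]
    linarith

theorem fract_of_mem_beattySet {α : ℝ} (hα : 1 < α) (hirr : Irrational α) {m : ℕ}
    (hm : m ∈ beattySet α) : 1 - α⁻¹ < Int.fract (m * α⁻¹) := by
  have hα0 : 0 < α := one_pos.trans hα
  obtain ⟨n, hn, hmn⟩ := hm
  rw [beattySeq, eq_comm, Int.floor_eq_iff] at hmn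
  push_cast at hmn
  obtain ⟨h1, h2⟩ := hmn
  -- Irrationality excludes `m = n * α`, where the fractional part would be 0.
  have h1' : (m : ℝ) < n * α :=
    lt_of_le_of_ne h1 fun h => (hirr.natCast_mul hn.ne').ne_nat m h.symm
  rw [← div_lt_iff₀ hα0, div_eq_mul_inv] at h1'
  rw [← lt_div_iff₀ hα0, div_eq_mul_inv, add_mul, one_mul] at h2
  have hinv : α⁻¹ < 1 := inv_lt_one_of_one_lt₀ hα
  have hfl : ⌊(m : ℝ) * α⁻¹⌋ = (n : ℤ) - 1 := by
    rw [Int.floor_eq_iff]; push_cast; constructor <;> linarith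
  rw [Int.fract, hfl]
  push_cast
  linarith

theorem le_eval_of_natDegree_pos (f : ℕ[X]) (hf : 0 < f.natDegree) (n : ℕ) : n ≤ f.eval n := by
  rw [eval_eq_sum_range]
  have h := Finset.single_le_sum (f := fun i => f.coeff i * n ^ i) (fun i _ => Nat.zero_le _)
    (Finset.self_mem_range_succ f.natDegree)
  refine le_trans ?_ h
  have hc : 0 < f.coeff f.natDegree :=
    Nat.pos_of_ne_zero fun h => by
      rw [coeff_natDegree, leadingCoeff_eq_zero] at h; simp [h] at hf
  exact (Nat.le_self_pow hf.ne' n).trans (Nat.le_mul_of_pos_left _ hc)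

/-! ### Estimates for upper density -/

theorem upperAsymptoticDensity_le_of_eventually_le {A : Set ℕ} {g : ℕ → ℝ} {d : ℝ}
    (hle : ∀ N, densityUpTo A N ≤ g N) (hg : Tendsto g atTop (𝓝 d)) :
    upperAsymptoticDensity A ≤ d := by
  rw [upperAsymptoticDensity, ← hg.limsup_eq]
  exact limsup_le_limsup (Eventually.of_forall hle)
    (isCoboundedUnder_le_of_le _ (densityUpTo_nonneg A)) hg.isBoundedUnder_le

theorem densityUpTo_mono {A B : Set ℕ} (h : A ⊆ B) (N : ℕ) : densityUpTo A N ≤ densityUpTo B N := by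
  unfold densityUpTo
  gcongr
  exact Set.Finite.inter_of_right (Set.finite_Icc 1 N) B

theorem densityUpTo_union_le (A B : Set ℕ) (N : ℕ) :
    densityUpTo (A ∪ B) N ≤ densityUpTo A N + densityUpTo B N := by
  unfold densityUpTo
  rw [← add_div, Set.union_inter_distrib_right]
  gcongr
  exact_mod_cast Set.ncard_union_le _ _

theorem densityUpTo_biUnion_le {ι : Type*} (s : Finset ι) (Q : ι → Set ℕ) (N : ℕ) :
    densityUpTo (⋃ j ∈ s, Q j) N ≤ ∑ j ∈ s, densityUpTo (Q j) N := by
  classical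
  induction s using Finset.induction_on with
  | empty => simp [densityUpTo]
  | insert j s hj ih =>
    rw [Finset.set_biUnion_insert, Finset.sum_insert hj]
    exact (densityUpTo_union_le _ _ N).trans (by gcongr)

theorem densityUpTo_Iic_le (M N : ℕ) : densityUpTo (Set.Iic M) N ≤ ((M : ℝ) + 1) / N := by
  unfold densityUpTo
  gcongr
  have h := Set.ncard_le_ncard (Set.inter_subset_left (s := Set.Iic M) (t := Set.Icc 1 N))
    (Set.finite_Iic M)
  rw [← Finset.coe_Iic, Set.ncard_coe_finset, Nat.card_Iic] at h
  exact_mod_cast (by simpa using h)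

theorem upperAsymptoticDensity_le_of_subset {ι : Type*} {A : Set ℕ} (M : ℕ) (s : Finset ι)
    (Q : ι → Set ℕ) {d : ℝ} (hQ : ∀ j ∈ s, HasAsymptoticDensity (Q j) d)
    (hA : ∀ a ∈ A, M < a → ∃ j ∈ s, a ∈ Q j) : upperAsymptoticDensity A ≤ s.card * d := by
  refine upperAsymptoticDensity_le_of_eventually_le
    (g := fun N => ((M : ℝ) + 1) / N + ∑ j ∈ s, densityUpTo (Q j) N) (fun N => ?_) ?_
  · have hsub : A ⊆ Set.Iic M ∪ ⋃ j ∈ s, Q j := fun a ha => by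
      rcases le_or_gt a M with h | h
      · exact Or.inl h
      · obtain ⟨j, hj, haj⟩ := hA a ha h
        exact Or.inr (Set.mem_biUnion hj haj)
    refine (densityUpTo_mono hsub N).trans ((densityUpTo_union_le _ _ N).trans ?_)
    exact add_le_add (densityUpTo_Iic_le M N) (densityUpTo_biUnion_le s Q N)
  · simpa using (tendsto_const_div_atTop_nhds_zero_nat ((M : ℝ) + 1)).add
      (tendsto_finsetSum s hQ)

theorem hasAsymptoticDensity_infinite {A : Set ℕ} {d : ℝ} (hd : 0 < d)
    (hA : HasAsymptoticDensity A d) : A.Infinite := by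
  intro hfin
  obtain ⟨M, hM⟩ := hfin.bddAbove
  have h0 : Tendsto (fun N : ℕ => ((M : ℝ) + 1) / N) atTop (𝓝 0) :=
    tendsto_const_div_atTop_nhds_zero_nat _
  exact hd.not_ge (le_of_tendsto_of_tendsto' hA h0 fun N =>
    (densityUpTo_mono (fun a ha => hM ha) N).trans (densityUpTo_Iic_le M N))

/-! ### The upper bound by Cauchy–Davenport -/

theorem intCast_floor_mul_eq_iff (p : ℕ) [NeZero p] (y : ℝ) (j : ZMod p) :
    ((⌊(p : ℝ) * y⌋ : ℤ) : ZMod p) = j ↔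
      Int.fract y ∈ Set.Ico ((j.val : ℝ) / p) ((j.val + 1 : ℝ) / p) := by
  have hp : (0 : ℝ) < p := by exact_mod_cast NeZero.pos p
  have e : ⌊(p : ℝ) * y⌋ = ⌊(p : ℝ) * Int.fract y⌋ + p * ⌊y⌋ := by
    conv_lhs => rw [← Int.fract_add_floor y, mul_add]
    exact_mod_cast Int.floor_add_intCast ((p : ℝ) * Int.fract y) (p * ⌊y⌋)
  have h0 : 0 ≤ ⌊(p : ℝ) * Int.fract y⌋ :=
    Int.floor_nonneg.2 (mul_nonneg hp.le (Int.fract_nonneg y))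
  have h1 : ⌊(p : ℝ) * Int.fract y⌋ < p :=
    Int.floor_lt.2 (by simpa using mul_lt_of_lt_one_right hp (Int.fract_lt_one y))
  rw [e]
  push_cast
  rw [ZMod.natCast_self, zero_mul, add_zero, Set.mem_Ico, div_le_iff₀ hp, lt_div_iff₀ hp,
    mul_comm (Int.fract y)]
  trans ⌊(p : ℝ) * Int.fract y⌋ = (j.val : ℤ)
  · constructor
    · rintro rfl
      rw [ZMod.val_intCast, Int.emod_eq_of_lt h0 h1]
    · intro h
      rw [h]; simp
  · rw [Int.floor_eq_iff]; simp

open Pointwise in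
/-- The Cauchy–Davenport theorem for iterated sumsets. -/
theorem min_le_card_nsmul {p : ℕ} (hp : p.Prime) {E : Finset (ZMod p)} (hE : E.Nonempty) (k : ℕ) :
    min p (k * (E.card - 1) + 1) ≤ (k • E).card := by
  induction k with
  | zero => simp
  | succ k ih =>
    have h := ZMod.cauchy_davenport hp (hE.nsmul (n := k)) hE
    have hc := hE.card_pos
    rw [← succ_nsmul] at h
    rw [add_mul, one_mul]
    omega

open Pointwise in
/-- A bound for the density of `A` when no sum over large elements of `A` is in the Beatty set:
compare the residues `⌊p * f(a) / α⌋` modulo a prime `p` with Cauchy–Davenport. -/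
theorem upperAsymptoticDensity_le_of_disjoint {α : ℝ} (hα : 1 < α) (hirr : Irrational α) {k : ℕ}
    (hk : 1 ≤ k) (f : ℕ[X]) (hf : 0 < f.natDegree) {A : Set ℕ} (hApos : ∀ a ∈ A, 0 < a) (M : ℕ)
    (hA : ∀ a : Fin k → ℕ, (∀ i, a i ∈ A ∧ M < a i) → ∑ i, f.eval (a i) ∉ beattySet α)
    {p : ℕ} (hp : p.Prime) (hpk : (k : ℝ) + 1 < p * α⁻¹) (hpos : 0 < upperAsymptoticDensity A) :
    p * (k * upperAsymptoticDensity A) ≤ p * (1 - α⁻¹) + 2 * k := by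
  classical
  have : Fact p.Prime := ⟨hp⟩
  have hp0 : (0 : ℝ) < p := by exact_mod_cast hp.pos
  have hα0 : 0 < α := one_pos.trans hα
  have hinv : α⁻¹ < 1 := inv_lt_one_of_one_lt₀ hα
  set r : ℕ → ZMod p := fun a => ((⌊(p : ℝ) * (f.eval a * α⁻¹)⌋ : ℤ) : ZMod p) with hr
  set E : Finset (ZMod p) := Finset.univ.filter fun j => ∃ a ∈ A, M < a ∧ r a = j with hE
  have hdens : upperAsymptoticDensity A ≤ E.card * (1 / p) := by
    refine upperAsymptoticDensity_le_of_subset M E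
      (fun j => {n | 0 < n ∧ Int.fract ((f.eval n : ℕ) * α⁻¹) ∈
        Set.Ico ((j.val : ℝ) / p) ((j.val + 1 : ℝ) / p)}) (fun j _ => ?_) fun a ha hMa =>
        ⟨r a, by simp only [hE, Finset.mem_filter_univ]; exact ⟨a, ha, hMa, rfl⟩, hApos a ha,
          (intCast_floor_mul_eq_iff p _ _).1 rfl⟩
    have hj : (j.val : ℝ) + 1 ≤ p := by exact_mod_cast j.val_lt
    convert hasAsymptoticDensity_fract_eval_mul f hf hirr.inv (a := (j.val : ℝ) / p)
      (b := (j.val + 1 : ℝ) / p) (by positivity) (by gcongr; linarith) ((div_le_one hp0).2 hj)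
      using 1
    ring
  have hEne : E.Nonempty := by
    rw [Finset.nonempty_iff_ne_empty]
    rintro h
    rw [h] at hdens
    simp at hdens
    linarith
  -- The sum of the `k` floors falls short of `p * s` by at most `k`. Removing `p * ⌊s⌋` keeps the
  -- residue, and `p * Int.fract s` is at most `p * (1 - α⁻¹)`.
  have hsub : k • E ⊆ (Finset.Icc (-(k : ℤ)) ⌊(p : ℝ) * (1 - α⁻¹)⌋).image
      (Int.cast : ℤ → ZMod p) := by
    intro c hc
    obtain ⟨e, he⟩ : ∃ e : Fin k → ZMod p, (∀ i, e i ∈ E) ∧ c = ∑ i, e i := by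
      obtain ⟨e, rfl⟩ := Finset.mem_nsmul.1 hc
      exact ⟨fun i => e i, fun i => (e i).2, by rw [List.sum_ofFn]⟩
    obtain ⟨heE, rfl⟩ := he
    have hex : ∀ i, ∃ a ∈ A, M < a ∧ r a = e i := fun i => by simpa [hE] using heE i
    choose a haA hMa hra using hex
    set s : ℝ := ((∑ i, f.eval (a i) : ℕ) : ℝ) * α⁻¹ with hs
    have hfr : Int.fract s ≤ 1 - α⁻¹ := by
      by_contra! h
      exact hA a (fun i => ⟨haA i, hMa i⟩) (mem_beattySet_of_fract hα h)
    have hps : (p : ℝ) * s = ∑ i, (p : ℝ) * (f.eval (a i) * α⁻¹) := by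
      rw [hs, ← Finset.mul_sum, ← Finset.sum_mul]; push_cast; rfl
    have hup : ((∑ i, ⌊(p : ℝ) * (f.eval (a i) * α⁻¹)⌋ : ℤ) : ℝ) ≤ p * s := by
      rw [hps]; push_cast
      exact Finset.sum_le_sum fun i _ => Int.floor_le _
    have hlo : p * s - k ≤ ((∑ i, ⌊(p : ℝ) * (f.eval (a i) * α⁻¹)⌋ : ℤ) : ℝ) := by
      rw [hps, sub_le_iff_le_add]; push_cast
      have : (k : ℝ) = ∑ i : Fin k, (1 : ℝ) := by simp
      rw [this, ← Finset.sum_add_distrib]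
      exact Finset.sum_le_sum fun i _ => (Int.lt_floor_add_one _).le
    have hfs := Int.floor_add_fract s
    have hps2 : (p : ℝ) * s = p * ⌊s⌋ + p * Int.fract s := by rw [← mul_add, hfs]
    have hf0 : 0 ≤ p * Int.fract s := mul_nonneg hp0.le (Int.fract_nonneg s)
    have hf1 : p * Int.fract s ≤ p * (1 - α⁻¹) := by gcongr
    refine Finset.mem_image.2 ⟨∑ i, ⌊(p : ℝ) * (f.eval (a i) * α⁻¹)⌋ - p * ⌊s⌋,
      Finset.mem_Icc.2 ⟨?_, Int.le_floor.2 ?_⟩, ?_⟩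
    · have : (-(k : ℤ) : ℝ) ≤ ((∑ i, ⌊(p : ℝ) * (f.eval (a i) * α⁻¹)⌋ - p * ⌊s⌋ : ℤ) : ℝ) := by
        rw [Int.cast_sub]; push_cast at hlo ⊢; linarith
      exact_mod_cast this
    · rw [Int.cast_sub]; push_cast at hup ⊢; linarith
    · rw [Int.cast_sub, Int.cast_sum]
      simp [← hra, hr]
  have hcard := (min_le_card_nsmul hp hEne k).trans ((Finset.card_le_card hsub).trans
    Finset.card_image_le)
  rw [Int.card_Icc] at hcard
  have hfl0 : 0 ≤ ⌊(p : ℝ) * (1 - α⁻¹)⌋ :=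
    Int.floor_nonneg.2 (mul_nonneg hp0.le (by linarith))
  have hup : ((min p (k * (E.card - 1) + 1) : ℕ) : ℝ) ≤ p * (1 - α⁻¹) + k + 1 := by
    have h1 : ((min p (k * (E.card - 1) + 1) : ℕ) : ℤ) ≤ ⌊(p : ℝ) * (1 - α⁻¹)⌋ + k + 1 := by omega
    have h2 : ((min p (k * (E.card - 1) + 1) : ℕ) : ℝ) ≤ ⌊(p : ℝ) * (1 - α⁻¹)⌋ + k + 1 := by
      exact_mod_cast h1
    linarith [Int.floor_le ((p : ℝ) * (1 - α⁻¹))]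
  rw [mul_one_div, le_div_iff₀ hp0] at hdens
  -- A minimum equal to `p` would force `p * α⁻¹ ≤ k + 1`, against `hpk`.
  rcases min_choice p (k * (E.card - 1) + 1) with h | h
  · rw [h] at hup; linarith
  · rw [h] at hup
    push_cast [Nat.cast_sub hEne.card_pos] at hup
    have hk0 : (0 : ℝ) ≤ k := by positivity
    nlinarith [mul_le_mul_of_nonneg_left hdens hk0]

theorem infinite_inter_beattySet {α : ℝ} (hα : 1 < α) (hirr : Irrational α) {k : ℕ}
    (hk : 1 ≤ k) (f : ℕ[X]) (hf : 0 < f.natDegree) {A : Set ℕ} (hApos : ∀ a ∈ A, 0 < a)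
    (hd : 1 - α⁻¹ < k * upperAsymptoticDensity A) :
    (kFoldSums f k A ∩ beattySet α).Infinite := by
  intro hfin
  obtain ⟨M, hM⟩ := hfin.bddAbove
  have hα0 : 0 < α := one_pos.trans hα
  have hinv : α⁻¹ < 1 := inv_lt_one_of_one_lt₀ hα
  have hinv0 : 0 < α⁻¹ := inv_pos.2 hα0
  have hpos : 0 < upperAsymptoticDensity A :=
    pos_of_mul_pos_right (lt_trans (by linarith) hd) (Nat.cast_nonneg k)
  -- The first bound rules out a sumset filling all residues; the second makes the error `2 * k`
  -- smaller than `p` times the excess density.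
  obtain ⟨n, hn⟩ := exists_nat_gt
    (max (((k : ℝ) + 1) / α⁻¹) (2 * k / (k * upperAsymptoticDensity A - (1 - α⁻¹))))
  obtain ⟨p, hnp, hp⟩ := Nat.exists_infinite_primes n
  have hnp' : (n : ℝ) ≤ p := by exact_mod_cast hnp
  have h1 := ((le_max_left _ _).trans_lt hn).trans_le hnp'
  have h2 := ((le_max_right _ _).trans_lt hn).trans_le hnp'
  rw [div_lt_iff₀ hinv0] at h1
  rw [div_lt_iff₀ (by linarith)] at h2
  -- As `n ≤ f(n)`, a sum over elements beyond `M` exceeds `M`, hence is not among the finitely many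
  -- exceptions.
  have h := upperAsymptoticDensity_le_of_disjoint hα hirr hk f hf hApos M (fun a ha hmem => by
    have hle := hM ⟨⟨a, fun i => (ha i).1, rfl⟩, hmem⟩
    have h0 := Finset.single_le_sum (f := fun i => f.eval (a i)) (fun i _ => Nat.zero_le _)
      (Finset.mem_univ (⟨0, hk⟩ : Fin k))
    exact absurd (((ha ⟨0, hk⟩).2.trans_le (le_eval_of_natDegree_pos f hf _)).trans_le
      (h0.trans hle)) (lt_irrefl _)) hp h1 hpos
  linarith

theorem kFoldSums_inter_beattySet_eq_empty {α : ℝ} (hα : 1 < α) (hirr : Irrational α) {k : ℕ}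
    (hk : 1 ≤ k) (f : ℕ[X]) {A : Set ℕ}
    (hA : ∀ a ∈ A, Int.fract ((f.eval a : ℕ) * α⁻¹) < (1 - α⁻¹) / k) :
    kFoldSums f k A ∩ beattySet α = ∅ := by
  rw [Set.eq_empty_iff_forall_notMem]
  rintro _ ⟨⟨a, ha, rfl⟩, hm⟩
  have hα0 : 0 < α := one_pos.trans hα
  have hk0 : (0 : ℝ) < k := by exact_mod_cast hk
  have h := fract_of_mem_beattySet hα hirr hm
  have hsum : ∑ i, Int.fract ((f.eval (a i) : ℕ) * α⁻¹) ≤ 1 - α⁻¹ := by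
    refine (Finset.sum_le_sum fun i _ => (hA _ (ha i)).le).trans ?_
    simp; field_simp; rfl
  -- The fractional parts total at most `1 - α⁻¹ < 1`, so no carry occurs.
  have hfr : Int.fract (((∑ i, f.eval (a i) : ℕ) : ℝ) * α⁻¹) =
      ∑ i, Int.fract ((f.eval (a i) : ℕ) * α⁻¹) := by
    rw [Int.fract_eq_iff]
    refine ⟨Finset.sum_nonneg fun i _ => Int.fract_nonneg _,
      by linarith [inv_pos.2 hα0], ∑ i, ⌊((f.eval (a i) : ℕ) : ℝ) * α⁻¹⌋, ?_⟩
    push_cast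
    rw [Finset.sum_mul, ← Finset.sum_sub_distrib]
    exact Finset.sum_congr rfl fun i _ => Int.self_sub_fract _
  linarith

/-- `f` is a nonconstant polynomial whose nonzero coefficients are positive integers. -/
theorem corollary1p3 (α : ℝ) (hα : 1 < α) (hirr : Irrational α) (k : ℕ) (hk : 2 ≤ k)
    (f : ℕ[X]) (hf : 0 < f.natDegree) :
    0 < 1 / (k : ℝ) - 1 / ((k : ℝ) * α) ∧
    (∃ A : Set ℕ, (∀ a ∈ A, 0 < a) ∧ A.Infinite ∧
      HasAsymptoticDensity A (1 / (k : ℝ) - 1 / ((k : ℝ) * α)) ∧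
      kFoldSums f k A ∩ beattySet α = ∅) ∧
    (∀ A : Set ℕ, (∀ a ∈ A, 0 < a) → kFoldSums f k A ∩ beattySet α = ∅ →
      upperAsymptoticDensity A ≤ 1 / (k : ℝ) - 1 / ((k : ℝ) * α)) ∧
    (∀ A : Set ℕ, (∀ a ∈ A, 0 < a) →
      1 / (k : ℝ) - 1 / ((k : ℝ) * α) < upperAsymptoticDensity A →
      (kFoldSums f k A ∩ beattySet α).Infinite) := by
  have hα0 : 0 < α := one_pos.trans hα
  have hk1 : 1 ≤ k := by omega
  have hk0 : (0 : ℝ) < k := by exact_mod_cast hk1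
  have hinv : α⁻¹ < 1 := inv_lt_one_of_one_lt₀ hα
  have hd : 1 / (k : ℝ) - 1 / ((k : ℝ) * α) = (1 - α⁻¹) / k := by field_simp
  rw [hd]
  have hdpos : 0 < (1 - α⁻¹) / k := div_pos (by linarith) hk0
  have hd1 : (1 - α⁻¹) / k ≤ 1 := by
    rw [div_le_one hk0]
    have : (1 : ℝ) ≤ k := by exact_mod_cast hk1
    linarith [inv_pos.2 hα0]
  have hinf : ∀ A : Set ℕ, (∀ a ∈ A, 0 < a) → (1 - α⁻¹) / k < upperAsymptoticDensity A →
      (kFoldSums f k A ∩ beattySet α).Infinite := fun A hA h =>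
    infinite_inter_beattySet hα hirr hk1 f hf hA (by rwa [div_lt_iff₀' hk0] at h)
  refine ⟨hdpos, ?_, fun A hA hempty => ?_, hinf⟩
  · have hdens := hasAsymptoticDensity_fract_eval_mul f hf hirr.inv le_rfl hdpos.le hd1
    rw [sub_zero] at hdens
    exact ⟨_, fun a ha => ha.1, hasAsymptoticDensity_infinite hdpos hdens, hdens,
      kFoldSums_inter_beattySet_eq_empty hα hirr hk1 f fun a ha => ha.2.2⟩
  · by_contra! h
    have := hinf A hA h
    rw [hempty] at this
    exact this Set.finite_empty
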